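/- Let $R$ be a commutative ring with identity and let $d \ge 0$ be an integer. An $R$-module $M$ is said to have a finite projective resolution if there exist an integer $n \ge 0$ and an exact sequence $$0 \to P_n \to P_{n-1} \to \cdots \to P_1 \to P_0 \to M \to 0$$ of $R$-modules in which every $P_i$ is finitely generated and projective. The small finitistic dimension $\mathrm{fPD}(R)$ of $R$ is the supremum of the projective dimensions of all $R$-modules that have a finite projective resolution. Then the following are equivalent: (a) $\mathrm{fPD}(R) \le d$; (b) for every finitely generated ideal $I$ of $R$, if $\mathrm{Ext}^i_R(R/I,R)=0$ for each $i=0,\dots,d$, then $\mathrm{Ext}^i_R(R/I,R)=0$ for all $i\ge 0$. -/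

import Mathlib

universe u

/-- `M` has a finite projective resolution: there are a natural number `n` and an exact sequence
`0 → P n → ⋯ → P 1 → P 0 → M → 0` of `R`-modules in which every `P i` is finitely generated and
projective. The sequence is written as one indexed by all of `ℕ` that is zero beyond `n`. -/
def HasFiniteProjectiveResolution (R : Type u) [CommRing R] (M : ModuleCat.{u} R) : Prop :=
  ∃ (n : ℕ) (P : ℕ → ModuleCat.{u} R) (δ : ∀ i, P (i + 1) →ₗ[R] P i) (ε : P 0 →ₗ[R] M),
    (∀ i, Module.Finite R (P i) ∧ Module.Projective R (P i)) ∧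
    (∀ i, n < i → Subsingleton (P i)) ∧
    Function.Surjective ε ∧
    Function.Exact (δ 0) ε ∧
    ∀ i, Function.Exact (δ (i + 1)) (δ i)

/-- The small finitistic (projective) dimension `fPD(R)`: the supremum of the projective
dimensions of the `R`-modules that have a finite projective resolution. The value lies in
`{-∞} ∪ ℕ ∪ {∞}`, since Mathlib gives the zero module the projective dimension `⊥`. -/
noncomputable def smallFinitisticDimension (R : Type u) [CommRing R] : WithBot ℕ∞ :=
  ⨆ (M : ModuleCat.{u} R) (_ : HasFiniteProjectiveResolution R M),
    CategoryTheory.projectiveDimension M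

/-! Both conditions say that a finitely generated `I` with `Ext^i(R/I, R) = 0` for all `i ≤ d` is
the unit ideal. A Koszul-type complex `K` on generators of `I` has cohomology killed by `I`, so
dimension shifting makes it exact in the degrees where these Ext groups vanish
(`koszul_exact_of_subsingleton_ext`). If all of them vanish, a determinant cocycle gives `1 ∈ I`. If
they vanish up to `d`, then `K^0 → ⋯ → K^(d+1)` resolves its last cokernel; when `fPD(R) ≤ d`, the
map `K^0 → K^1` splits, and again `1 ∈ I`. Conversely, let the syzygy `Z (m+1)` of a finite
resolution be projective, `m ≥ d`, and let `I` be the ideal of maximal minors of `Z (m+1) → P m`.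
McCoy's theorem applied to Ext groups, which `I` kills, gives `Ext^k(R/I, R) = 0` for `k ≤ d`. Hence
`I = R`, the inclusion splits and `Z m` is projective (`projective_syzygy_of_succ`); descend to `Z
d`. -/

/-! ### Functoriality of Ext in the second variable -/

section ExtMap

open CategoryTheory CategoryTheory.Abelian

variable {R : Type u} [CommRing R] (X : ModuleCat.{u} R) (k : ℕ)
variable {M N P : Type u} [AddCommGroup M] [Module R M] [AddCommGroup N] [Module R N]
  [AddCommGroup P] [Module R P]

/-- The map induced on `Ext X - k` by a linear map. -/
noncomputable def extMap (f : M →ₗ[R] N) :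
    Ext.{u} X (ModuleCat.of R M) k →ₗ[R] Ext.{u} X (ModuleCat.of R N) k where
  toFun e := e.comp (Ext.mk₀ (ModuleCat.ofHom f)) (add_zero k)
  map_add' := by simp
  map_smul' := by simp

lemma extMap_apply (f : M →ₗ[R] N) (e : Ext.{u} X (ModuleCat.of R M) k) :
    extMap X k f e = e.comp (Ext.mk₀ (ModuleCat.ofHom f)) (add_zero k) := rfl

lemma extMap_id (e : Ext.{u} X (ModuleCat.of R M) k) : extMap X k LinearMap.id e = e :=
  e.comp_mk₀_id

lemma extMap_comp (g : N →ₗ[R] P) (f : M →ₗ[R] N) (e : Ext.{u} X (ModuleCat.of R M) k) :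
    extMap X k (g ∘ₗ f) e = extMap X k g (extMap X k f e) := by
  simp [extMap_apply, ← ModuleCat.ofHom_comp]

lemma extMap_add (f g : M →ₗ[R] N) (e : Ext.{u} X (ModuleCat.of R M) k) :
    extMap X k (f + g) e = extMap X k f e + extMap X k g e := by
  simp [extMap_apply, ModuleCat.ofHom_add, Ext.mk₀_add]

lemma extMap_smul (r : R) (f : M →ₗ[R] N) (e : Ext.{u} X (ModuleCat.of R M) k) :
    extMap X k (r • f) e = r • extMap X k f e := by
  rw [extMap_apply, extMap_apply, ← Ext.comp_smul, ← Ext.mk₀_smul]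
  rfl

lemma extMap_zero (e : Ext.{u} X (ModuleCat.of R M) k) :
    extMap X k (0 : M →ₗ[R] N) e = 0 := by
  simpa using extMap_smul X k (0 : R) (0 : M →ₗ[R] N) e

lemma extMap_sum {ι : Type*} (s : Finset ι) (f : ι → M →ₗ[R] N)
    (e : Ext.{u} X (ModuleCat.of R M) k) :
    extMap X k (∑ i ∈ s, f i) e = ∑ i ∈ s, extMap X k (f i) e := by
  classical
  induction s using Finset.induction_on with
  | empty => simp [extMap_zero]
  | insert a s ha ih => simp [Finset.sum_insert ha, extMap_add, ih]

/-- An `Ext` class with values in a finite power of a module vanishes when all its components do. -/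
lemma ext_pi_eq_zero {ι : Type} [Fintype ι] (e : Ext.{u} X (ModuleCat.of R (ι → M)) k)
    (h : ∀ i, extMap X k (LinearMap.proj i : (ι → M) →ₗ[R] M) e = 0) : e = 0 := by
  classical
  have hid : (LinearMap.id : (ι → M) →ₗ[R] (ι → M)) =
      ∑ i, LinearMap.single R (fun _ : ι => M) i ∘ₗ LinearMap.proj i := by
    ext i m j
    simp [Finset.sum_apply, Pi.single_apply]
  rw [← extMap_id X k e, hid, extMap_sum]
  exact Finset.sum_eq_zero fun i _ => by rw [extMap_comp, h, map_zero]

lemma subsingleton_ext_pi {ι : Type} [Fintype ι]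
    (h : Subsingleton (Ext.{u} X (ModuleCat.of R M) k)) :
    Subsingleton (Ext.{u} X (ModuleCat.of R (ι → M)) k) :=
  subsingleton_of_forall_eq 0 fun e => ext_pi_eq_zero X k e fun _ => Subsingleton.elim _ _

variable {X k} in
lemma extMap_injective_of_leftInverse {f : M →ₗ[R] N} {g : N →ₗ[R] M} (h : g ∘ₗ f = LinearMap.id) :
    Function.Injective (extMap X k f) := fun a b hab => by
  rw [← extMap_id X k a, ← extMap_id X k b, ← h, extMap_comp, extMap_comp, hab]

lemma subsingleton_ext_of_retract {f : M →ₗ[R] N} {g : N →ₗ[R] M} (h : g ∘ₗ f = LinearMap.id)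
    (hN : Subsingleton (Ext.{u} X (ModuleCat.of R N) k)) :
    Subsingleton (Ext.{u} X (ModuleCat.of R M) k) :=
  (extMap_injective_of_leftInverse h).subsingleton

lemma subsingleton_ext_of_finite_projective [Module.Finite R M] [Module.Projective R M]
    (h : Subsingleton (Ext.{u} X (ModuleCat.of R R) k)) :
    Subsingleton (Ext.{u} X (ModuleCat.of R M) k) := by
  obtain ⟨n, f, g, -, -, hfg⟩ := Module.Finite.exists_comp_eq_id_of_projective R M
  exact subsingleton_ext_of_retract X k hfg (subsingleton_ext_pi X k h)

section ShortExact

variable {f : M →ₗ[R] N} {g : N →ₗ[R] P}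

lemma moduleCat_shortExact (hf : Function.Injective f) (hfg : Function.Exact f g)
    (hg : Function.Surjective g) :
    (ModuleCat.shortComplexOfCompEqZero f g hfg.linearMap_comp_eq_zero).ShortExact :=
  ModuleCat.shortComplex_shortExact _ hfg hf hg

lemma subsingleton_ext_quotient (hf : Function.Injective f) (hfg : Function.Exact f g)
    (hg : Function.Surjective g) (hN : Subsingleton (Ext.{u} X (ModuleCat.of R N) k))
    (hM : Subsingleton (Ext.{u} X (ModuleCat.of R M) (k + 1))) :
    Subsingleton (Ext.{u} X (ModuleCat.of R P) k) := by
  refine subsingleton_of_forall_eq 0 fun e => ?_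
  obtain ⟨y, rfl⟩ := Ext.covariant_sequence_exact₃ X (moduleCat_shortExact hf hfg hg) e rfl
    (hM.elim _ _)
  rw [hN.elim y 0, Ext.zero_comp]

lemma extMap_injective_of_subsingleton (hf : Function.Injective f) (hfg : Function.Exact f g)
    (hg : Function.Surjective g) (hP : Subsingleton (Ext.{u} X (ModuleCat.of R P) k)) :
    Function.Injective (extMap X (k + 1) f) := by
  rw [injective_iff_map_eq_zero]
  intro e he
  obtain ⟨y, rfl⟩ := Ext.covariant_sequence_exact₁ X (moduleCat_shortExact hf hfg hg) e he rfl
  rw [hP.elim y 0, Ext.zero_comp]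

lemma extMap_zero_injective (hf : Function.Injective f) : Function.Injective (extMap X 0 f) :=
  haveI : Mono (ModuleCat.ofHom f) := (ModuleCat.mono_iff_injective _).mpr hf
  Ext.postcomp_mk₀_injective_of_mono X (ModuleCat.ofHom f)

end ShortExact

end ExtMap

/-! ### The action of `I` on Ext out of `R ⧸ I` -/

section Annihilator

open CategoryTheory CategoryTheory.Abelian

variable {R : Type u} [CommRing R] {I : Ideal R}
  {M : Type u} [AddCommGroup M] [Module R M]

lemma smul_ext_quotient_eq_zero {r : R} (hr : r ∈ I) {Y : ModuleCat.{u} R} {k : ℕ}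
    (e : Ext.{u} (ModuleCat.of R (R ⧸ I)) Y k) : r • e = 0 := by
  have h : r • 𝟙 (ModuleCat.of R (R ⧸ I)) = 0 := by
    refine ModuleCat.hom_ext (LinearMap.ext fun y => ?_)
    obtain ⟨y, rfl⟩ := Ideal.Quotient.mk_surjective y
    change Ideal.Quotient.mk I (r * y) = 0
    exact Ideal.Quotient.eq_zero_iff_mem.mpr (I.mul_mem_right _ hr)
  rw [← e.mk₀_id_comp, ← Ext.smul_comp, ← Ext.mk₀_smul, h, Ext.mk₀_zero, Ext.zero_comp]

lemma eq_zero_of_subsingleton_ext_zero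
    (h : Subsingleton (Ext.{u} (ModuleCat.of R (R ⧸ I)) (ModuleCat.of R M) 0))
    {z : M} (hz : ∀ r ∈ I, r • z = 0) : z = 0 := by
  let f : (R ⧸ I) →ₗ[R] M := Submodule.liftQ I (LinearMap.toSpanSingleton R M z)
    fun r hr => by simpa using hz r hr
  have hf : ModuleCat.ofHom f = 0 := by
    rw [← Ext.mk₀_eq_zero_iff]
    exact h.elim _ _
  have hf' : f = 0 := by simpa using congrArg ModuleCat.Hom.hom hf
  have h1 : f (Submodule.Quotient.mk 1) = 0 := by rw [hf', LinearMap.zero_apply]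
  simpa only [f, Submodule.liftQ_apply, LinearMap.toSpanSingleton_apply, one_smul] using h1

end Annihilator

/-! ### A non-alternating Koszul complex -/

section Koszul

variable {R : Type u} [CommRing R] {ι : Type*} (x : ι → R)

/-- The differential of the complex of (not necessarily alternating) Koszul cochains of a family of
ring elements. -/
def koszulDiff (i : ℕ) : ((Fin i → ι) → R) →ₗ[R] ((Fin (i + 1) → ι) → R) where
  toFun f j := ∑ k : Fin (i + 1), (-1) ^ (k : ℕ) * (x (j k) * f fun l => j (k.succAbove l))
  map_add' f g := by
    ext j
    simp [mul_add, Finset.sum_add_distrib]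
  map_smul' r f := by
    ext j
    simp only [Pi.smul_apply, smul_eq_mul, RingHom.id_apply, Finset.mul_sum]
    exact Finset.sum_congr rfl fun k _ => by ring

lemma koszulDiff_apply (i : ℕ) (f : (Fin i → ι) → R) (j : Fin (i + 1) → ι) :
    koszulDiff x i f j =
      ∑ k : Fin (i + 1), (-1) ^ (k : ℕ) * (x (j k) * f fun l => j (k.succAbove l)) := rfl

/-- Contraction `f ↦ f (a, ·)` is a homotopy from multiplication by `x a` to zero. Both `d² = 0` and
the annihilation of cohomology follow from this. -/
lemma koszulDiff_cons (i : ℕ) (f : (Fin (i + 1) → ι) → R) (a : ι) (j : Fin (i + 1) → ι) :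
    koszulDiff x (i + 1) f (Fin.cons a j) =
      x a * f j - koszulDiff x i (fun j' => f (Fin.cons a j')) j := by
  rw [koszulDiff_apply, Fin.sum_univ_succ, koszulDiff_apply, sub_eq_add_neg,
    ← Finset.sum_neg_distrib]
  congr 1
  · simp
  · refine Finset.sum_congr rfl fun k _ => ?_
    have h : (fun l => (Fin.cons a j : Fin (i + 2) → ι) (k.succ.succAbove l)) =
        Fin.cons a fun l => j (k.succAbove l) := by
      ext l
      induction l using Fin.cases <;> simp
    rw [h, Fin.val_succ, Fin.cons_succ]
    ring

lemma koszulDiff_zero_apply (f : (Fin 0 → ι) → R) (j : Fin 1 → ι) :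
    koszulDiff x 0 f j = x (j 0) * f default := by
  simp [koszulDiff_apply, Subsingleton.elim (fun l : Fin 0 => _) default]

lemma koszulDiff_koszulDiff (i : ℕ) (f : (Fin i → ι) → R) :
    koszulDiff x (i + 1) (koszulDiff x i f) = 0 := by
  induction i with
  | zero =>
    ext j
    rw [← Fin.cons_self_tail j, koszulDiff_cons, koszulDiff_zero_apply, koszulDiff_zero_apply,
      koszulDiff_zero_apply]
    simp [Fin.tail]
    ring
  | succ i ih =>
    ext j
    rw [← Fin.cons_self_tail j, koszulDiff_cons]
    have h : (fun j' => koszulDiff x (i + 1) f (Fin.cons (j 0) j')) =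
        x (j 0) • f - koszulDiff x i fun j' => f (Fin.cons (j 0) j') := by
      ext j'
      rw [koszulDiff_cons]
      rfl
    rw [h, map_sub, ih, map_smul, sub_zero]
    simp

/-- The coboundaries in degree `i`. -/
def koszulBoundary : (i : ℕ) → Submodule R ((Fin i → ι) → R)
  | 0 => ⊥
  | i + 1 => LinearMap.range (koszulDiff x i)

lemma koszulBoundary_le_ker (i : ℕ) : koszulBoundary x i ≤ LinearMap.ker (koszulDiff x i) := by
  cases i with
  | zero => exact bot_le
  | succ i =>
    rintro _ ⟨f, rfl⟩
    exact koszulDiff_koszulDiff x i f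

/-- Each `x a` acts by zero on the cohomology of the Koszul complex. -/
lemma smul_mem_koszulBoundary {i : ℕ} {f : (Fin i → ι) → R} (hf : koszulDiff x i f = 0) (a : ι) :
    x a • f ∈ koszulBoundary x i := by
  cases i with
  | zero =>
    have h := congrFun hf fun _ => a
    rw [koszulDiff_zero_apply] at h
    rw [koszulBoundary, Submodule.mem_bot]
    ext j
    rw [Subsingleton.elim j default]
    exact h
  | succ i =>
    refine ⟨fun j' => f (Fin.cons a j'), ?_⟩
    ext j
    have h := congrFun hf (Fin.cons a j)
    rw [koszulDiff_cons] at h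
    exact (sub_eq_zero.mp h).symm

/-- Coboundaries take values in the ideal generated by the family. -/
lemma koszulBoundary_apply_mem {i : ℕ} {f : (Fin i → ι) → R} (hf : f ∈ koszulBoundary x i)
    (j : Fin i → ι) : f j ∈ Ideal.span (Set.range x) := by
  cases i with
  | zero =>
    rw [koszulBoundary, Submodule.mem_bot] at hf
    simp [hf]
  | succ i =>
    obtain ⟨g, rfl⟩ := hf
    rw [koszulDiff_apply]
    exact Ideal.sum_mem _ fun k _ => Ideal.mul_mem_left _ _
      (Ideal.mul_mem_right _ _ (Ideal.subset_span (Set.mem_range_self _)))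

/-- If the Koszul complex of a family of `n` elements has no cohomology in degree `n`, then the
family generates the unit ideal. -/
lemma span_range_eq_top_of_ker_le {n : ℕ} (x : Fin n → R)
    (h : LinearMap.ker (koszulDiff x n) ≤ koszulBoundary x n) :
    Ideal.span (Set.range x) = ⊤ := by
  -- The determinant cochain plays the role of the top exterior form: a cocycle with value `1` at
  -- the identity.
  let f : (Fin n → Fin n) → R := fun j => Matrix.det (Matrix.of fun a b => if a = j b then 1 else 0)
  have hf : koszulDiff x n f = 0 := by
    ext j
    let A : Matrix (Fin (n + 1)) (Fin (n + 1)) R := Matrix.of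
      (Fin.cons (fun k => x (j k)) fun a k => if a = j k then 1 else 0)
    have hA : koszulDiff x n f j = A.det := by
      rw [Matrix.det_succ_row_zero, koszulDiff_apply]
      refine Finset.sum_congr rfl fun k _ => ?_
      rw [mul_assoc]
      rfl
    -- The top row of `A` is the combination of the others with coefficients `x a`; the coefficient
    -- `1` and the adjugate then force `det A = 0`.
    have hv : Matrix.vecMul (Fin.cons 1 fun a => -x a) A = 0 := by
      ext k
      simp [Matrix.vecMul, dotProduct, Fin.sum_univ_succ, A]
    have h0 := congrArg (fun w => Matrix.vecMul w A.adjugate 0) hv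
    rw [hA]
    simpa [Matrix.vecMul_vecMul, Matrix.mul_adjugate, Matrix.vecMul_smul] using h0
  have h1 := koszulBoundary_apply_mem x (h hf) id
  rw [Ideal.eq_top_iff_one]
  convert h1
  have : (Matrix.of fun a b : Fin n => if a = id b then (1 : R) else 0) = 1 := by
    ext a b
    simp [Matrix.one_apply]
  simp only [f, this, Matrix.det_one]

/-- The quotient of the Koszul cochains of degree `i` by the coboundaries. -/
abbrev KoszulCoker (i : ℕ) : Type _ := ((Fin i → ι) → R) ⧸ koszulBoundary x i

/-- The map induced by the Koszul differential on the quotient by the coboundaries. -/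
def koszulCokerMap (i : ℕ) : KoszulCoker x i →ₗ[R] ((Fin (i + 1) → ι) → R) :=
  (koszulBoundary x i).liftQ (koszulDiff x i) (koszulBoundary_le_ker x i)

lemma koszulCokerMap_exact (i : ℕ) :
    Function.Exact (koszulCokerMap x i) (koszulBoundary x (i + 1)).mkQ := by
  rw [LinearMap.exact_iff, Submodule.ker_mkQ, koszulCokerMap, Submodule.range_liftQ]
  rfl

lemma koszulCokerMap_injective {i : ℕ}
    (h : LinearMap.ker (koszulDiff x i) ≤ koszulBoundary x i) :
    Function.Injective (koszulCokerMap x i) := by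
  rw [← LinearMap.ker_eq_bot]
  exact Submodule.ker_liftQ_eq_bot _ _ _ h

/-- The quotient by the coboundaries in degree zero is the ring itself. -/
noncomputable def koszulCokerZeroEquiv : KoszulCoker x 0 ≃ₗ[R] R :=
  (Submodule.quotEquivOfEqBot _ rfl).trans (LinearEquiv.funUnique (Fin 0 → ι) R R)

end Koszul

/-! ### Vanishing of Ext and exactness of the Koszul complex -/

section Grade

open CategoryTheory CategoryTheory.Abelian

variable {R : Type u} [CommRing R] {n : ℕ} (x : Fin n → R)

/-- The class of a cocycle in the cokernel is killed by the ideal, while `Hom(R/I, -) = 0` forbids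
nonzero such elements. -/
lemma koszul_exact_of_subsingleton_ext_coker {i : ℕ}
    (h : Subsingleton (Ext.{u} (ModuleCat.of R (R ⧸ Ideal.span (Set.range x)))
      (ModuleCat.of R (KoszulCoker x i)) 0)) :
    LinearMap.ker (koszulDiff x i) ≤ koszulBoundary x i := by
  intro f hf
  rw [← Submodule.Quotient.mk_eq_zero]
  refine eq_zero_of_subsingleton_ext_zero h fun r hr => ?_
  rw [← Submodule.Quotient.mk_smul, Submodule.Quotient.mk_eq_zero]
  induction hr using Submodule.span_induction with
  | mem r hr =>
    obtain ⟨a, rfl⟩ := hr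
    exact smul_mem_koszulBoundary x hf a
  | zero => simp
  | add r s _ _ hr hs => rw [add_smul]; exact add_mem hr hs
  | smul r s _ hs => rw [smul_assoc]; exact Submodule.smul_mem _ _ hs

/-- The vanishing of `Ext (R ⧸ I) R` up to degree `m` shifts along the Koszul complex. -/
lemma subsingleton_ext_koszulCoker {m : ℕ}
    (h : ∀ i ≤ m, Subsingleton (Ext.{u} (ModuleCat.of R (R ⧸ Ideal.span (Set.range x)))
      (ModuleCat.of R R) i)) (i : ℕ) :
    ∀ j, j + i ≤ m → Subsingleton (Ext.{u} (ModuleCat.of R (R ⧸ Ideal.span (Set.range x)))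
      (ModuleCat.of R (KoszulCoker x i)) j) := by
  induction i with
  | zero =>
    intro j hj
    exact subsingleton_ext_of_retract _ _ (f := (koszulCokerZeroEquiv x).toLinearMap)
      (g := (koszulCokerZeroEquiv x).symm.toLinearMap) (by ext; simp) (h j (by omega))
  | succ i ih =>
    intro j hj
    exact subsingleton_ext_quotient _ _
      -- Left exactness in degree `i` is the `Hom` case `j = 0` of the induction hypothesis.
      (koszulCokerMap_injective x (koszul_exact_of_subsingleton_ext_coker x (ih 0 (by omega))))
      (koszulCokerMap_exact x i) (Submodule.mkQ_surjective _)
      (subsingleton_ext_of_finite_projective _ _ (h j (by omega)))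
      (ih (j + 1) (by omega))

lemma koszul_exact_of_subsingleton_ext {m : ℕ}
    (h : ∀ i ≤ m, Subsingleton (Ext.{u} (ModuleCat.of R (R ⧸ Ideal.span (Set.range x)))
      (ModuleCat.of R R) i)) {i : ℕ} (hi : i ≤ m) :
    LinearMap.ker (koszulDiff x i) ≤ koszulBoundary x i :=
  koszul_exact_of_subsingleton_ext_coker x (subsingleton_ext_koszulCoker x h i 0 (by omega))

/-- A finitely generated ideal `I` for which all `Ext (R ⧸ I) R` vanish is the unit ideal. -/
lemma Ideal.FG.eq_top_of_subsingleton_ext {I : Ideal R} (hI : I.FG)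
    (h : ∀ i, Subsingleton (Ext.{u} (ModuleCat.of R (R ⧸ I)) (ModuleCat.of R R) i)) :
    I = ⊤ := by
  obtain ⟨n, x, rfl⟩ := Submodule.fg_iff_exists_fin_generating_family.mp hI
  exact span_range_eq_top_of_ker_le x
    (koszul_exact_of_subsingleton_ext (m := n) x (fun i _ => h i) le_rfl)

end Grade

/-! ### Maximal minors and McCoy's theorem -/

section Minors

variable {R : Type*} [CommRing R] {κ : Type*} {r : ℕ}

/-- The ideal generated by the maximal minors of a matrix with `r` columns. -/
def maximalMinorsIdeal (A : Matrix κ (Fin r) R) : Ideal R :=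
  Ideal.span (Set.range fun h : Fin r → κ => (A.submatrix h id).det)

lemma maximalMinorsIdeal_fg [Finite κ] (A : Matrix κ (Fin r) R) : (maximalMinorsIdeal A).FG :=
  Submodule.fg_span (Set.finite_range _)

lemma det_submatrix_mem_maximalMinorsIdeal (A : Matrix κ (Fin r) R) (h : Fin r → κ)
    (g : Fin r → Fin r) : (A.submatrix h g).det ∈ maximalMinorsIdeal A := by
  have hA : A.submatrix h g = A.submatrix h id * (1 : Matrix (Fin r) (Fin r) R).submatrix id g := by
    ext a b
    simp [Matrix.mul_apply, Matrix.one_apply]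
  rw [hA, Matrix.det_mul]
  exact Ideal.mul_mem_right _ _ (Ideal.subset_span (Set.mem_range_self h))

/-- A matrix whose maximal minors generate the unit ideal has a left inverse. -/
lemma exists_mul_eq_one_of_maximalMinorsIdeal_eq_top [Fintype κ] [DecidableEq κ]
    {A : Matrix κ (Fin r) R} (hA : maximalMinorsIdeal A = ⊤) :
    ∃ L : Matrix (Fin r) κ R, L * A = 1 := by
  -- Cramer's rule handles a single minor; left inverses up to a scalar add up.
  have key : ∀ a ∈ maximalMinorsIdeal A, ∃ L : Matrix (Fin r) κ R, L * A = a • 1 := by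
    intro a ha
    induction ha using Submodule.span_induction with
    | mem a ha =>
      obtain ⟨h, rfl⟩ := ha
      refine ⟨(A.submatrix h id).adjugate * (1 : Matrix κ κ R).submatrix h id, ?_⟩
      have hs : (1 : Matrix κ κ R).submatrix h id * A = A.submatrix h id := by
        ext a b
        simp [Matrix.mul_apply, Matrix.one_apply]
      rw [Matrix.mul_assoc, hs, Matrix.adjugate_mul]
    | zero => exact ⟨0, by simp⟩
    | add a b _ _ ha hb =>
      obtain ⟨L, hL⟩ := ha
      obtain ⟨L', hL'⟩ := hb
      exact ⟨L + L', by rw [Matrix.add_mul, hL, hL', add_smul]⟩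
    | smul c a _ ha =>
      obtain ⟨L, hL⟩ := ha
      exact ⟨c • L, by rw [Matrix.smul_mul, hL, smul_assoc]⟩
  simpa using key 1 (hA ▸ Submodule.mem_top)

variable {E : Type*} [AddCommGroup E] [Module R E]

/-- **McCoy's theorem** for modules: if the maximal minors of a matrix kill `E` and the matrix acts
injectively on vectors with entries in `E`, then `E` is zero. -/
lemma subsingleton_of_maximalMinorsIdeal_smul_eq_zero (A : Matrix κ (Fin r) R)
    (hA : ∀ a ∈ maximalMinorsIdeal A, ∀ e : E, a • e = 0)
    (hinj : ∀ w : Fin r → E, (∀ l, ∑ c, A l c • w c = 0) → w = 0) : Subsingleton E := by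
  -- Descending induction on the size of the minors, down to the empty minor `1`.
  have key : ∀ t ≤ r, ∀ (h : Fin t → κ) (g : Fin t → Fin r) (e : E),
      (A.submatrix h g).det • e = 0 := by
    intro t ht
    induction ht using Nat.decreasingInduction with
    | self => exact fun h g e => hA _ (det_submatrix_mem_maximalMinorsIdeal A h g) e
    | of_succ t ht ih =>
      intro h g e
      obtain ⟨c₀, hc₀⟩ : ∃ c₀, ∀ b, g b ≠ c₀ := by
        by_contra! hg
        have := Fintype.card_le_of_surjective g hg
        simp only [Fintype.card_fin] at this
        omega
      let g' : Fin (t + 1) → Fin r := Fin.cons c₀ g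
      let q : Fin (t + 1) → R := fun k =>
        (-1) ^ (k : ℕ) * (A.submatrix h fun b => g' (k.succAbove b)).det
      -- Cofactors times `e`: row `l` of `A` sends them to a minor of size `t + 1`, which kills `e`.
      -- The entry at the new column `c₀` is the given minor of size `t`.
      have hw := hinj (fun c => (∑ k, if g' k = c then q k else 0) • e) fun l => by
        have hl := ih (Fin.cons l h) g' e
        rw [Matrix.det_succ_row_zero] at hl
        simp only [smul_smul]
        rw [← Finset.sum_smul, ← hl]
        congr 1
        simp only [Finset.mul_sum]
        rw [Finset.sum_comm]
        refine Finset.sum_congr rfl fun k _ => ?_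
        simp only [mul_ite, mul_zero, Finset.sum_ite_eq, Finset.mem_univ, if_true]
        rw [mul_comm ((-1) ^ (k : ℕ)), mul_assoc]
        rfl
      have h0 := congrFun hw c₀
      simpa [Fin.sum_univ_succ, g', q, hc₀] using h0
  refine subsingleton_of_forall_eq 0 fun e => ?_
  simpa using key 0 (Nat.zero_le r) Fin.elim0 Fin.elim0 e

end Minors

/-! ### McCoy's theorem on Ext groups -/

section ExtMinors

open CategoryTheory CategoryTheory.Abelian

variable {R : Type u} [CommRing R]

lemma subsingleton_ext_of_extMap_toLin_injective {r s : ℕ} (X : ModuleCat.{u} R) (k : ℕ)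
    (f : (Fin r → R) →ₗ[R] (Fin s → R))
    (hX : ∀ a ∈ maximalMinorsIdeal (LinearMap.toMatrix' f),
      ∀ e : Ext.{u} X (ModuleCat.of R R) k, a • e = 0)
    (hf : Function.Injective (extMap X k f)) :
    Subsingleton (Ext.{u} X (ModuleCat.of R R) k) := by
  refine subsingleton_of_maximalMinorsIdeal_smul_eq_zero _ hX fun w hw => ?_
  let y := ∑ c, extMap X k (LinearMap.single R (fun _ : Fin r => R) c) (w c)
  have hy : y = 0 := by
    refine hf ?_
    rw [map_zero]
    refine ext_pi_eq_zero X k _ fun l => ?_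
    rw [← hw l, map_sum, map_sum]
    refine Finset.sum_congr rfl fun c _ => ?_
    rw [← extMap_comp, ← extMap_comp]
    have : (LinearMap.proj l ∘ₗ f) ∘ₗ LinearMap.single R (fun _ : Fin r => R) c =
        LinearMap.toMatrix' f l c • LinearMap.id := by
      ext
      simp [LinearMap.toMatrix'_apply]
    rw [this, extMap_smul, extMap_id]
  ext c
  have hc : extMap X k (LinearMap.proj c : (Fin r → R) →ₗ[R] R) y = w c := by
    rw [map_sum, Finset.sum_eq_single c]
    · rw [← extMap_comp, LinearMap.proj_comp_single_same, extMap_id]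
    · intro b _ hb
      rw [← extMap_comp, LinearMap.proj_comp_single_ne _ _ _ _ hb.symm, extMap_zero]
    · simp
  rw [← hc, hy, map_zero, Pi.zero_apply]

variable {M N : Type u} [AddCommGroup M] [Module R M] [AddCommGroup N] [Module R N]
  [Module.Finite R M] [Module.Projective R M] [Module.Finite R N] [Module.Projective R N]

/-- A linear map of finitely generated projective modules has a finitely generated ideal of
maximal minors of a matrix presentation: it controls both the existence of a left inverse and injectivity on `Ext`. -/
lemma exists_ideal_leftInverse_and_ext (f : M →ₗ[R] N) : ∃ I : Ideal R, I.FG ∧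
    (I = ⊤ → ∃ g : N →ₗ[R] M, g ∘ₗ f = LinearMap.id) ∧
    ∀ k, Function.Injective (extMap (ModuleCat.of R (R ⧸ I)) k f) →
      Subsingleton (Ext.{u} (ModuleCat.of R (R ⧸ I)) (ModuleCat.of R R) k) := by
  obtain ⟨r, π, σ, -, -, hM⟩ := Module.Finite.exists_comp_eq_id_of_projective R M
  obtain ⟨s, p, q, -, -, hN⟩ := Module.Finite.exists_comp_eq_id_of_projective R (N × (Fin r → R))
  -- `R^r` is `M` plus a complement; `f` acts on `M`, the identity on the complement, so that `F`
  -- inherits injectivity on Ext from `f`.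
  let F : (Fin r → R) →ₗ[R] (Fin s → R) :=
    q ∘ₗ (f ∘ₗ π).prod (LinearMap.id - σ ∘ₗ π)
  refine ⟨maximalMinorsIdeal (LinearMap.toMatrix' F), maximalMinorsIdeal_fg _, fun hI => ?_,
    fun k hk => ?_⟩
  · obtain ⟨L, hL⟩ := exists_mul_eq_one_of_maximalMinorsIdeal_eq_top hI
    refine ⟨π ∘ₗ Matrix.toLin' L ∘ₗ q ∘ₗ LinearMap.inl R N (Fin r → R), ?_⟩
    have hL' : Matrix.toLin' L ∘ₗ F = LinearMap.id := by
      rw [← Matrix.toLin'_toMatrix' F, ← Matrix.toLin'_mul, hL, Matrix.toLin'_one]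
    ext m
    have hm : π (σ m) = m := LinearMap.congr_fun hM m
    have hF : F (σ m) = q (f m, 0) := by simp [F, hm]
    have := LinearMap.congr_fun hL' (σ m)
    rw [LinearMap.comp_apply, hF] at this
    simp only [LinearMap.comp_apply, LinearMap.inl_apply, this, LinearMap.id_apply, hm]
  · refine subsingleton_ext_of_extMap_toLin_injective _ k F
      (fun a ha e => smul_ext_quotient_eq_zero ha e) ?_
    rw [injective_iff_map_eq_zero]
    intro y hy
    rw [extMap_comp] at hy
    replace hy := extMap_injective_of_leftInverse hN (hy.trans (map_zero _).symm)
    have h1 := extMap_comp (ModuleCat.of R (R ⧸ maximalMinorsIdeal (LinearMap.toMatrix' F))) k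
      (LinearMap.fst R N (Fin r → R)) ((f ∘ₗ π).prod (LinearMap.id - σ ∘ₗ π)) y
    have h2 := extMap_comp (ModuleCat.of R (R ⧸ maximalMinorsIdeal (LinearMap.toMatrix' F))) k
      (LinearMap.snd R N (Fin r → R)) ((f ∘ₗ π).prod (LinearMap.id - σ ∘ₗ π)) y
    rw [hy, map_zero, LinearMap.fst_prod, extMap_comp] at h1
    rw [hy, map_zero, LinearMap.snd_prod] at h2
    have h3 := hk (h1.trans (map_zero _).symm)
    have h4 := extMap_add (ModuleCat.of R (R ⧸ maximalMinorsIdeal (LinearMap.toMatrix' F))) k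
      (LinearMap.id - σ ∘ₗ π) (σ ∘ₗ π) y
    rwa [sub_add_cancel, extMap_id, h2, extMap_comp, h3, map_zero, zero_add] at h4

end ExtMinors

/-! ### Finite projective resolutions and the two implications -/

section FiniteProjectiveResolution

open CategoryTheory CategoryTheory.Abelian

variable {R : Type u} [CommRing R]

lemma HasFiniteProjectiveResolution.of_projective (M : Type u) [AddCommGroup M] [Module R M]
    [Module.Finite R M] [Module.Projective R M] :
    HasFiniteProjectiveResolution R (ModuleCat.of R M) := by
  let P : ℕ → ModuleCat.{u} R
    | 0 => ModuleCat.of R M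
    | _ + 1 => ModuleCat.of R PUnit
  have hP : ∀ i, Subsingleton (P (i + 1)) := fun i => inferInstanceAs (Subsingleton PUnit.{u + 1})
  refine ⟨0, P, fun _ => 0, LinearMap.id, ?_, ?_, Function.surjective_id, ?_, ?_⟩
  · rintro (_ | i)
    · exact ⟨inferInstanceAs (Module.Finite R M), inferInstanceAs (Module.Projective R M)⟩
    · exact ⟨inferInstanceAs (Module.Finite R PUnit.{u + 1}), inferInstanceAs (Module.Projective R PUnit.{u + 1})⟩
  · rintro (_ | i) hi
    · omega
    · exact hP i
  · intro y
    exact ⟨fun h => ⟨0, h.symm⟩, fun ⟨_, h⟩ => h.symm⟩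
  · intro i y
    exact ⟨fun _ => ⟨0, (hP i).elim _ _⟩, fun _ => rfl⟩

lemma HasFiniteProjectiveResolution.of_exact {A B C : Type u} [AddCommGroup A] [Module R A]
    [AddCommGroup B] [Module R B] [AddCommGroup C] [Module R C]
    [Module.Finite R B] [Module.Projective R B] {f : A →ₗ[R] B} {g : B →ₗ[R] C}
    (hf : Function.Injective f) (hfg : Function.Exact f g) (hg : Function.Surjective g)
    (hA : HasFiniteProjectiveResolution R (ModuleCat.of R A)) :
    HasFiniteProjectiveResolution R (ModuleCat.of R C) := by
  obtain ⟨n, P, δ, ε, hP, hn, hε, h0, hδ⟩ := hA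
  let P' : ℕ → ModuleCat.{u} R
    | 0 => ModuleCat.of R B
    | i + 1 => P i
  let δ' : ∀ i, P' (i + 1) →ₗ[R] P' i
    | 0 => f ∘ₗ ε
    | i + 1 => δ i
  refine ⟨n + 1, P', δ', g, ?_, ?_, hg, ?_, ?_⟩
  · rintro (_ | i)
    · exact ⟨inferInstanceAs (Module.Finite R B), inferInstanceAs (Module.Projective R B)⟩
    · exact hP i
  · rintro (_ | i) hi
    · omega
    · exact hn i (by omega)
  · exact (Function.Surjective.comp_exact_iff_exact hε).mpr hfg
  · rintro (_ | i)
    · exact (Function.Injective.comp_exact_iff_exact hf).mpr h0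
    · exact hδ i

/-- A module with a finite projective resolution is the zeroth term of a sequence of syzygies that
eventually vanish. -/
lemma HasFiniteProjectiveResolution.exists_syzygies {M : ModuleCat.{u} R}
    (hM : HasFiniteProjectiveResolution R M) :
    ∃ (n : ℕ) (P Z : ℕ → ModuleCat.{u} R) (f : ∀ i, Z (i + 1) →ₗ[R] P i)
      (g : ∀ i, P i →ₗ[R] Z i),
      (∀ i, Module.Finite R (P i) ∧ Module.Projective R (P i)) ∧ (∀ i, n < i → Subsingleton (Z i)) ∧
      (∀ i, Function.Injective (f i)) ∧ (∀ i, Function.Exact (f i) (g i)) ∧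
      (∀ i, Function.Surjective (g i)) ∧ Nonempty (Z 0 ≃ₗ[R] M) := by
  obtain ⟨n, P, δ, ε, hP, hn, hε, h0, hδ⟩ := hM
  -- Syzygies as cokernels: `Z 0` is then `M`, and `Z i` vanishes with `P i`.
  refine ⟨n, P, fun i => ModuleCat.of R (P i ⧸ LinearMap.range (δ i)),
    fun i => (LinearMap.range (δ (i + 1))).liftQ (δ i) (hδ i).linearMap_ker_eq.ge,
    fun i => (LinearMap.range (δ i)).mkQ, hP, ?_, ?_, ?_, ?_, ?_⟩
  · intro i hi
    have := hn i hi
    exact (Submodule.mkQ_surjective (LinearMap.range (δ i))).subsingleton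
  · intro i
    rw [← LinearMap.ker_eq_bot]
    exact Submodule.ker_liftQ_eq_bot _ _ _ (hδ i).linearMap_ker_eq.le
  · intro i
    rw [LinearMap.exact_iff, Submodule.ker_mkQ, Submodule.range_liftQ]
  · exact fun i => Submodule.mkQ_surjective _
  · exact ⟨(Submodule.quotEquivOfEq _ _ h0.linearMap_ker_eq.symm).trans
      (ε.quotKerEquivOfSurjective hε)⟩

/-- The descent step: a map of projectives occurring beyond degree `d` in a finite resolution
splits. -/
lemma projective_syzygy_of_succ {d : ℕ}
    (H : ∀ I : Ideal R, I.FG →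
      (∀ i : ℕ, i ≤ d →
        Subsingleton (Ext.{u} (ModuleCat.of R (R ⧸ I)) (ModuleCat.of R R) i)) → I = ⊤)
    {P Z : ℕ → ModuleCat.{u} R} {f : ∀ i, Z (i + 1) →ₗ[R] P i} {g : ∀ i, P i →ₗ[R] Z i}
    (hP : ∀ i, Module.Finite R (P i) ∧ Module.Projective R (P i))
    (hf : ∀ i, Function.Injective (f i)) (hfg : ∀ i, Function.Exact (f i) (g i))
    (hg : ∀ i, Function.Surjective (g i)) {m : ℕ} (hm : d ≤ m)
    (hZ : Module.Projective R (Z (m + 1))) : Module.Projective R (Z m) := by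
  have hPm := (hP m).1
  have hPm' := (hP m).2
  have hPm1 := (hP (m + 1)).1
  have hZf : Module.Finite R (Z (m + 1)) := Module.Finite.of_surjective _ (hg (m + 1))
  obtain ⟨I, hI, hsplit, hext⟩ := exists_ideal_leftInverse_and_ext (f m)
  have hvan : ∀ k, k ≤ d →
      Subsingleton (Ext.{u} (ModuleCat.of R (R ⧸ I)) (ModuleCat.of R R) k) := by
    intro k
    induction k using Nat.strong_induction_on with
    | _ k ih =>
      intro hk
      have hPvan : ∀ j < k, ∀ i,
          Subsingleton (Ext.{u} (ModuleCat.of R (R ⧸ I)) (ModuleCat.of R (P i)) j) := by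
        intro j hj i
        have h1 := (hP i).1
        have h2 := (hP i).2
        exact subsingleton_ext_of_finite_projective _ _ (ih j hj (by omega))
      -- Dimension shifting along `Z (i+1) → P i → Z i`; each syzygy gains one degree of vanishing.
      have hZvan : ∀ i j, j < i → j < k →
          Subsingleton (Ext.{u} (ModuleCat.of R (R ⧸ I)) (ModuleCat.of R (Z i)) j) := by
        intro i
        induction i with
        | zero => intro j hj; omega
        | succ i ihi =>
          rintro (_ | j) hji hjk
          · have := hPvan 0 hjk i
            exact (extMap_zero_injective _ (hf i)).subsingleton
          · have := hPvan (j + 1) hjk i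
            exact (extMap_injective_of_subsingleton _ _ (hf i) (hfg i) (hg i)
              (ihi j (by omega) (by omega))).subsingleton
      refine hext k ?_
      cases k with
      | zero => exact extMap_zero_injective _ (hf m)
      | succ k =>
        -- Here `d ≤ m` enters: `k + 1 ≤ d` gives `k < m`.
        exact extMap_injective_of_subsingleton _ _ (hf m) (hfg m) (hg m)
          (hZvan m k (by omega) (by omega))
  obtain ⟨l, hl⟩ := hsplit (H I hI hvan)
  obtain ⟨-, s, hs⟩ := ((hfg m).split_tfae'.out 1 0 rfl rfl).mp ⟨hg m, l, hl⟩
  exact Module.Projective.of_split s (g m) hs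

lemma HasFiniteProjectiveResolution.hasProjectiveDimensionLE {d : ℕ}
    (H : ∀ I : Ideal R, I.FG →
      (∀ i : ℕ, i ≤ d →
        Subsingleton (Ext.{u} (ModuleCat.of R (R ⧸ I)) (ModuleCat.of R R) i)) → I = ⊤)
    {M : ModuleCat.{u} R} (hM : HasFiniteProjectiveResolution R M) :
    HasProjectiveDimensionLE M d := by
  obtain ⟨n, P, Z, f, g, hP, hn, hf, hfg, hg, ⟨e⟩⟩ := hM.exists_syzygies
  have hproj : Module.Projective R (Z d) := by
    have h1 : Module.Projective R (Z (d + (n + 1))) := by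
      have := hn (d + (n + 1)) (by omega)
      infer_instance
    generalize n + 1 = k at h1
    induction k with
    | zero => exact h1
    | succ k ih => exact ih (projective_syzygy_of_succ H hP hf hfg hg (by omega) h1)
  have hdim : ∀ j ≤ d, HasProjectiveDimensionLT (Z (d - j)) (j + 1) := by
    intro j
    induction j with
    | zero =>
      intro _
      have : Projective (Z d) := (IsProjective.iff_projective _).mp hproj
      exact inferInstanceAs (HasProjectiveDimensionLT (Z d) 1)
    | succ j ih =>
      intro hj
      have h1 := ih (by omega)
      obtain ⟨i, hi⟩ : ∃ i, d - j = i + 1 := ⟨d - j - 1, by omega⟩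
      rw [hi] at h1
      rw [show d - (j + 1) = i by omega]
      have h2 : Projective (P i) := (IsProjective.iff_projective _).mp (hP i).2
      exact (moduleCat_shortExact (hf i) (hfg i) (hg i)).hasProjectiveDimensionLT_X₃ (j + 1) h1
        (hasProjectiveDimensionLT_of_ge (P i) 1 _ (by omega))
  have h0 := hdim d le_rfl
  rw [Nat.sub_self] at h0
  exact hasProjectiveDimensionLT_of_iso e.toModuleIso (d + 1)

/-- If modules with a finite projective resolution have projective dimension at most `d`, then
finitely generated ideals of grade greater than `d` are trivial. -/
lemma Ideal.FG.eq_top_of_hasProjectiveDimensionLE {d : ℕ}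
    (H : ∀ M : ModuleCat.{u} R, HasFiniteProjectiveResolution R M → HasProjectiveDimensionLE M d)
    {I : Ideal R} (hI : I.FG)
    (h : ∀ i ≤ d, Subsingleton (Ext.{u} (ModuleCat.of R (R ⧸ I)) (ModuleCat.of R R) i)) :
    I = ⊤ := by
  obtain ⟨n, x, rfl⟩ := Submodule.fg_iff_exists_fin_generating_family.mp hI
  have hinj : ∀ i ≤ d, Function.Injective (koszulCokerMap x i) := fun i hi =>
    koszulCokerMap_injective x (koszul_exact_of_subsingleton_ext x h hi)
  have hres : ∀ i ≤ d + 1,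
      HasFiniteProjectiveResolution R (ModuleCat.of R (KoszulCoker x i)) := by
    intro i
    induction i with
    | zero =>
      intro _
      have := Module.Projective.of_equiv (koszulCokerZeroEquiv x).symm
      exact .of_projective _
    | succ i ih =>
      intro hi
      exact .of_exact (hinj i (by omega)) (koszulCokerMap_exact x i)
        (Submodule.mkQ_surjective _) (ih (by omega))
  -- Each step back along the complex lowers the bound by one, ending with a projective cokernel in
  -- degree `1`.
  have hdim : ∀ i ≤ d + 1, 1 ≤ i →
      HasProjectiveDimensionLT (ModuleCat.of R (KoszulCoker x i)) i := by
    intro i hi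
    induction hi using Nat.decreasingInduction with
    | self => exact fun _ => H _ (hres _ le_rfl)
    | of_succ i hi ih =>
      intro h1
      have hK : Projective (ModuleCat.of R ((Fin (i + 1) → Fin n) → R)) :=
        (IsProjective.iff_projective _).mp inferInstance
      exact (moduleCat_shortExact (hinj i (by omega)) (koszulCokerMap_exact x i)
        (Submodule.mkQ_surjective _)).hasProjectiveDimensionLT_X₁ i
        (hasProjectiveDimensionLT_of_ge (ModuleCat.of R ((Fin (i + 1) → Fin n) → R)) 1 i h1)
        (ih (by omega))
  have hproj : Module.Projective R (KoszulCoker x 1) := by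
    have := hdim 1 (by omega) le_rfl
    exact (IsProjective.iff_projective _).mpr inferInstance
  obtain ⟨s, hs⟩ := Module.projective_lifting_property (koszulBoundary x 1).mkQ LinearMap.id
    (Submodule.mkQ_surjective _)
  obtain ⟨-, l, hl⟩ := ((koszulCokerMap_exact x 0).split_tfae'.out 0 1 rfl rfl).mp
    ⟨hinj 0 (by omega), s, hs⟩
  -- The differential of the unit cochain is the family `x` itself, so a retraction writes `1` as a
  -- combination of the generators.
  let v : (Fin 0 → Fin n) → R := fun _ => 1
  let φ : ((Fin 1 → Fin n) → R) →ₗ[R] R := (koszulCokerZeroEquiv x).toLinearMap ∘ₗ l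
  have hφ : φ (koszulDiff x 0 v) = 1 := by
    have h1 : l (koszulDiff x 0 v) = Submodule.Quotient.mk v :=
      LinearMap.congr_fun hl (Submodule.Quotient.mk v)
    simp only [φ, LinearMap.comp_apply, h1]
    rfl
  rw [Ideal.eq_top_iff_one, ← hφ, LinearMap.pi_apply_eq_sum_univ]
  refine Ideal.sum_mem _ fun j _ => Ideal.mul_mem_right _ _ ?_
  exact koszulBoundary_apply_mem x (LinearMap.mem_range_self (koszulDiff x 0) v) j

end FiniteProjectiveResolution

theorem theorem2p4 (R : Type u) [CommRing R] (d : ℕ) :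
    smallFinitisticDimension R ≤ (d : WithBot ℕ∞) ↔
      ∀ I : Ideal R, I.FG →
        (∀ i : ℕ, i ≤ d →
          Subsingleton (CategoryTheory.Abelian.Ext.{u}
            (ModuleCat.of R (R ⧸ I)) (ModuleCat.of R R) i)) →
        ∀ i : ℕ,
          Subsingleton (CategoryTheory.Abelian.Ext.{u}
            (ModuleCat.of R (R ⧸ I)) (ModuleCat.of R R) i) := by
  rw [smallFinitisticDimension, iSup₂_le_iff]
  simp only [CategoryTheory.projectiveDimension_le_iff]
  constructor
  · intro H I hI h i
    have hI' := hI.eq_top_of_hasProjectiveDimensionLE H h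
    refine subsingleton_of_forall_eq 0 fun e => ?_
    rw [← one_smul R e]
    exact smul_ext_quotient_eq_zero (hI' ▸ Submodule.mem_top) e
  · intro H M hM
    exact hM.hasProjectiveDimensionLE fun I hI h => hI.eq_top_of_subsingleton_ext (H I hI h)
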